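/- Let $\bar{\mathbb Q}\subseteq\mathbb C$ be the field of algebraic numbers and fix an embedding $i\colon\bar{\mathbb Q}\hookrightarrow\bar{\mathbb Q}_2$ into an algebraic closure of the field of $2$-adic numbers. Let $Z\subseteq\bar{\mathbb Q}$ be the subring of those $a$ for which $i(a)$ is integral over $\mathbb Z_2$, and let $\rho\colon\bar{\mathbb Q}\to\mathbb P^1(\bar{\mathbb F}_2)$ be the map that sends $a\in Z$ to the residue class of $i(a)$ modulo the maximal ideal of the valuation ring of $\bar{\mathbb Q}_2$ and $a\notin Z$ to $\infty$. For $A,B\in\mathbb C$ with $4A^3+27B^2\neq 0$ let $E_{A,B}$ be the elliptic curve $y^2=x^3+Ax+B$ over $\mathbb C$. For $\alpha\in\mathbb C$ let $P_\alpha(A,B)\in E_{A,B}(\mathbb C)$ be a point with $x$-coordinate $\alpha$ (unique up to sign), and set $$T_W(\alpha)=\{(A,B)\in\mathbb C^2 : 4A^3+27B^2\neq 0,\ P_\alpha(A,B)\text{ is a torsion point of }E_{A,B}\}$$ and $T_W(\alpha,\beta,\gamma)=T_W(\alpha)\cap T_W(\beta)\cap T_W(\gamma)$. **Corollary.** Let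 $\alpha,\beta,\gamma\in Z$ be such that $\rho(\alpha),\rho(\beta),\rho(\gamma)$ are pairwise distinct. Then $T_W(\alpha,\beta,\gamma)\cap(\mathbb C\times Z)$ is contained in $$\bigl\{(-(\alpha^2+\alpha\beta+\beta^2),\ \alpha\beta(\alpha+\beta)),\ (-(\alpha^2+\alpha\gamma+\gamma^2),\ \alpha\gamma(\alpha+\gamma)),\ (-(\beta^2+\beta\gamma+\gamma^2),\ \beta\gamma(\beta+\gamma))\bigr\}.$$ -/

import Mathlib

noncomputable section

namespace WeierstrassTorsion

/-- The field of algebraic numbers, as the algebraic closure of `ℚ` inside `ℂ`. -/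
abbrev QBar : IntermediateField ℚ ℂ := algebraicClosure ℚ ℂ

/-- The ring of integers of the fixed algebraic closure of `ℚ_[2]`, that is, the valuation
subring of the unique extension of the 2-adic valuation. -/
abbrev IntQ2Bar : ValuationSubring (PadicAlgCl 2) := (PadicAlgCl.valued 2).v.valuationSubring

/-- The subring `Z` of those algebraic numbers whose image under the embedding `i` into the
algebraic closure of `ℚ_[2]` is integral. -/
def Z (i : QBar →+* PadicAlgCl 2) : Subring QBar := IntQ2Bar.toSubring.comap i

open Classical in
/-- The reduction map `ρ` attached to the embedding `i`. Its target is the projective line, written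
as the one-point extension, over the residue field of the algebraic closure of `ℚ_[2]`
(which is an algebraic closure of the field with two elements). -/
def rho (i : QBar →+* PadicAlgCl 2) (a : QBar) :
    OnePoint (IsLocalRing.ResidueField IntQ2Bar) :=
  if h : i a ∈ IntQ2Bar then
    ((IsLocalRing.residue IntQ2Bar ⟨i a, h⟩ : IsLocalRing.ResidueField IntQ2Bar) :
      OnePoint (IsLocalRing.ResidueField IntQ2Bar))
  else OnePoint.infty

/-- The Weierstrass curve `y² = x³ + A x + B` over `ℂ`. -/
def curve (A B : ℂ) : WeierstrassCurve ℂ := ⟨0, 0, 0, A, B⟩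

/-- The set of parameters `(A, B)` with `4 A³ + 27 B² ≠ 0` such that a point with
`x`-coordinate `a` on `y² = x³ + A x + B` has finite order. Such a point always exists over `ℂ`,
and it is unique up to sign, so that the choice of the point is irrelevant. -/
def TW (a : ℂ) : Set (ℂ × ℂ) :=
  {p | 4 * p.1 ^ 3 + 27 * p.2 ^ 2 ≠ 0 ∧
    ∃ (y : ℂ) (h : (curve p.1 p.2).toAffine.Nonsingular a y),
      IsOfFinAddOrder (WeierstrassCurve.Affine.Point.some a y h)}

/-- The set of parameters for which all `x`-coordinates in `S` are simultaneously torsion. -/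
def TWset (S : Set ℂ) : Set (ℂ × ℂ) := ⋂ a ∈ S, TW a

end WeierstrassTorsion

end

/-! Since `A` is an arbitrary complex number, the valuation behind `Z` is first extended to a
valuation `w` of `ℂ` with `w 2 < 1`. As `w 4 < 1`, the denominator `4 * y ^ 2` of the duplication
formula makes doubling expand `w x` once `w x > max 1 (w A)`, so such points have infinite order.
For integral `x` with `y ≠ 0`, doubling enters that region unless `w (x ^ 2 - A) < max 1 (w A)`. A
torsion `x` therefore has `y = 0`, or `A` is integral and `x ^ 2 ≡ A`; squaring is injective in
residue characteristic 2, so the latter allows only one residue class. Hence two of the three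
numbers are roots of the cubic, and these determine `A` and `B`. -/

namespace WeierstrassTorsion

open WeierstrassCurve.Affine

section Extension

variable {K L Γ : Type*} [Field K] [Field L] [LinearOrderedCommGroupWithZero Γ]

/-- A valuation on a field extends to any extension field, as far as the comparison with `1` is
concerned. -/
theorem exists_valuationSubring_extending (v : Valuation K Γ) (j : K →+* L) :
    ∃ V : ValuationSubring L, (∀ x, v x ≤ 1 → V.valuation (j x) ≤ 1) ∧
      ∀ x, v x < 1 → V.valuation (j x) < 1 := by
  obtain ⟨V, hle, hloc⟩ :=
    (v.valuationSubring.toLocalSubring.map j).exists_le_valuationSubring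
  have hmem : ∀ x, v x ≤ 1 → j x ∈ (v.valuationSubring.toLocalSubring.map j).toSubring :=
    fun x hx => ⟨x, hx, rfl⟩
  refine ⟨V, fun x hx => (V.valuation_le_one_iff _).2 (hle (hmem x hx)), fun x hx => ?_⟩
  have hxV : j x ∈ V := hle (hmem x hx.le)
  refine (V.valuation_lt_one_or_eq_one ⟨j x, hxV⟩).resolve_right fun h => ?_
  -- Domination: a unit of `V` lying in the image ring is already a unit there, so `x` would have an
  -- integral inverse.
  have hu : IsUnit (⟨j x, hmem x hx.le⟩ :
      (v.valuationSubring.toLocalSubring.map j).toSubring) :=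
    hloc.map_nonunit _ ((V.valuation_eq_one_iff ⟨j x, hxV⟩).2 h)
  obtain ⟨⟨_, y, hy, rfl⟩, hxy⟩ := isUnit_iff_exists_inv.1 hu
  have hxy : x * y = 1 := j.injective (by simpa using congrArg Subtype.val hxy)
  have hlt : v (x * y) < 1 := by
    rw [map_mul]
    exact mul_lt_one_of_lt_of_le hx hy
  exact hlt.ne (by rw [hxy, map_one])

end Extension

section Doubling

variable {A B x y : ℂ}

theorem curve_nonsingular_eq (h : (curve A B).toAffine.Nonsingular x y) :
    y ^ 2 = x ^ 3 + A * x + B := by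
  simpa [curve] using (equation_iff x y).1 h.1

theorem exists_double (h : (curve A B).toAffine.Nonsingular x y) (hy : y ≠ 0) :
    ∃ (x' y' : ℂ) (h' : (curve A B).toAffine.Nonsingular x' y'),
      Point.some x y h + Point.some x y h = Point.some x' y' h' ∧
        4 * y ^ 2 * x' = (x ^ 2 - A) ^ 2 - 8 * B * x := by
  have hne : y ≠ (curve A B).toAffine.negY x y := by
    simpa [negY, curve, self_eq_neg] using hy
  refine ⟨_, _, _, Point.add_self_of_Y_ne hne, ?_⟩
  have heq := curve_nonsingular_eq h
  rw [slope_of_Y_ne rfl hne]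
  simp only [addX, negY, curve]
  field_simp
  ring_nf
  grind

end Doubling

section Valuation

variable {Γ : Type*} [LinearOrderedCommGroupWithZero Γ] (w : Valuation ℂ Γ) {A B x y x' : ℂ}

theorem valuation_four_lt_one (h2 : w 2 < 1) : w 4 < 1 := by
  rw [show (4 : ℂ) = 2 * 2 by norm_num, map_mul]
  exact mul_lt_one_of_lt_of_le h2 h2.le

theorem valuation_eight_lt_one (h2 : w 2 < 1) : w 8 < 1 := by
  rw [show (8 : ℂ) = 4 * 2 by norm_num, map_mul]
  exact mul_lt_one_of_lt_of_le (valuation_four_lt_one w h2) h2.le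

/-- Far away from the integral points, doubling preserves the curve minus its `2`-torsion and
increases the absolute value of the `x`-coordinate. -/
theorem valuation_lt_of_double (h2 : w 2 < 1) (hB : w B ≤ 1) (h1 : 1 < w x) (hA : w A < w x)
    (hy : y ^ 2 = x ^ 3 + A * x + B) :
    y ≠ 0 ∧ (4 * y ^ 2 * x' = (x ^ 2 - A) ^ 2 - 8 * B * x → w x < w x') := by
  have h0 : 0 < w x := zero_lt_one.trans h1
  have hy2 : w (y ^ 2) = w x ^ 3 := by
    rw [hy, add_assoc, Valuation.map_add_eq_of_lt_left, map_pow]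
    refine Valuation.map_add_lt _ ?_ ?_
    · rw [map_mul, map_pow, pow_succ]
      refine mul_lt_mul_of_pos_right (hA.trans ?_) h0
      exact lt_self_pow₀ h1 (by norm_num)
    · rw [map_pow]
      exact hB.trans_lt (one_lt_pow₀ h1 (by norm_num))
  refine ⟨fun h => ?_, fun hx' => ?_⟩
  · rw [h] at hy2
    simp only [map_zero, ne_eq, OfNat.ofNat_ne_zero, not_false_eq_true, zero_pow] at hy2
    exact (pow_pos h0 3).ne hy2
  · have hnum : w ((x ^ 2 - A) ^ 2 - 8 * B * x) = w x ^ 4 := by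
      have hsq : w ((x ^ 2 - A) ^ 2) = w x ^ 4 := by
        rw [map_pow, Valuation.map_sub_eq_of_lt_left, map_pow, ← pow_mul]
        rw [map_pow]
        exact hA.trans (lt_self_pow₀ h1 (by norm_num))
      rw [Valuation.map_sub_eq_of_lt_left, hsq]
      rw [hsq, map_mul, map_mul]
      calc w 8 * w B * w x ≤ 1 * w x := by
            gcongr
            exact mul_le_one' (valuation_eight_lt_one w h2).le hB
        _ < w x ^ 4 := by
            rw [one_mul]
            exact lt_self_pow₀ h1 (by norm_num)
    by_contra! hle
    rw [← hx', map_mul, map_mul, hy2] at hnum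
    refine absurd hnum (ne_of_lt ?_)
    calc w 4 * w x ^ 3 * w x' ≤ w 4 * w x ^ 3 * w x := by gcongr
      _ = w 4 * w x ^ 4 := by rw [mul_assoc, ← pow_succ]
      _ < 1 * w x ^ 4 := mul_lt_mul_of_pos_right (valuation_four_lt_one w h2) (pow_pos h0 4)
      _ = w x ^ 4 := one_mul _

/-- With `M = max 1 (w A)`, the numerator has value exactly `M ^ 2`, while `4 * y ^ 2` has value
less than `M`. -/
theorem max_lt_valuation_of_double (h2 : w 2 < 1) (hB : w B ≤ 1) (hx : w x ≤ 1)
    (hM : max 1 (w A) ≤ w (x ^ 2 - A)) (hy : y ^ 2 = x ^ 3 + A * x + B)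
    (hx' : 4 * y ^ 2 * x' = (x ^ 2 - A) ^ 2 - 8 * B * x) : max 1 (w A) < w x' := by
  set M := max 1 (w A) with hMdef
  have hM1 : 1 ≤ M := le_max_left _ _
  have hM0 : 0 < M := zero_lt_one.trans_le hM1
  have hxA : w (x ^ 2 - A) = M := by
    refine le_antisymm ((w.map_sub _ _).trans (max_le_max ?_ le_rfl)) hM
    rw [map_pow]
    exact pow_le_one₀ zero_le hx
  have hy2 : w (y ^ 2) ≤ M := by
    rw [hy]
    refine w.map_add_le (w.map_add_le ?_ ?_) (hB.trans hM1)
    · rw [map_pow]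
      exact (pow_le_one₀ zero_le hx).trans hM1
    · rw [map_mul]
      exact (mul_le_of_le_one_right' hx).trans (le_max_right _ _)
  have hnum : w ((x ^ 2 - A) ^ 2 - 8 * B * x) = M * M := by
    rw [Valuation.map_sub_eq_of_lt_left, map_pow, hxA, sq]
    rw [map_pow, hxA, map_mul, map_mul]
    calc w 8 * w B * w x < 1 :=
          mul_lt_one_of_lt_of_le (mul_lt_one_of_lt_of_le (valuation_eight_lt_one w h2) hB) hx
      _ ≤ M ^ 2 := one_le_pow₀ hM1
  by_contra! hle
  rw [← hx', map_mul, map_mul] at hnum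
  refine absurd hnum (ne_of_lt ?_)
  calc w 4 * w (y ^ 2) * w x' ≤ w 4 * M * M := by gcongr
    _ = w 4 * (M * M) := mul_assoc _ _ _
    _ < 1 * (M * M) := mul_lt_mul_of_pos_right (valuation_four_lt_one w h2) (mul_pos hM0 hM0)
    _ = M * M := one_mul _

end Valuation

section Torsion

variable {Γ : Type*} [LinearOrderedCommGroupWithZero Γ] (w : Valuation ℂ Γ) {A B x y : ℂ}

/-- The absolute value of the `x`-coordinate of an affine point, and `0` for the point at
infinity. -/
def valuationX : (curve A B).toAffine.Point → Γ
  | .zero => 0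
  | .some x _ _ => w x

theorem lt_valuationX_double (h2 : w 2 < 1) (hB : w B ≤ 1) (P : (curve A B).toAffine.Point)
    (hP : max 1 (w A) < valuationX w P) : valuationX w P < valuationX w (P + P) := by
  match P, hP with
  | .zero, hP => exact absurd hP not_lt_zero
  | .some x y h, hP =>
    obtain ⟨h1, hA⟩ := max_lt_iff.1 hP
    have heq := curve_nonsingular_eq h
    obtain ⟨x', y', h', hadd, hx'⟩ :=
      exists_double h (valuation_lt_of_double w (x' := x) h2 hB h1 hA heq).1
    rw [hadd]
    exact (valuation_lt_of_double w h2 hB h1 hA heq).2 hx'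

/-- Repeated doubling strictly increases `valuationX`, so the multiples `2 ^ k • P` are pairwise
distinct. -/
theorem not_isOfFinAddOrder_of_max_lt (h2 : w 2 < 1) (hB : w B ≤ 1)
    (P : (curve A B).toAffine.Point) (hP : max 1 (w A) < valuationX w P) :
    ¬ IsOfFinAddOrder P := by
  have hsucc : ∀ k : ℕ, (2 ^ (k + 1)) • P = (2 ^ k) • P + (2 ^ k) • P := fun k => by
    rw [pow_succ, mul_two, add_nsmul]
  have hfar : ∀ k : ℕ, max 1 (w A) < valuationX w ((2 ^ k) • P) := fun k => by
    induction k with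
    | zero => simpa using hP
    | succ k ih =>
      rw [hsucc]
      exact ih.trans (lt_valuationX_double w h2 hB _ ih)
  have hmono : StrictMono fun k : ℕ => valuationX w ((2 ^ k) • P) :=
    strictMono_nat_of_lt_succ fun k => by
      rw [hsucc]
      exact lt_valuationX_double w h2 hB _ (hfar k)
  intro hfin
  have hinj : Function.Injective fun k : ℕ => (2 ^ k) • P :=
    Function.Injective.of_comp (f := valuationX w) hmono.injective
  refine Set.infinite_range_of_injective hinj (hfin.finite_multiples.subset ?_)
  rintro _ ⟨k, rfl⟩
  exact ⟨2 ^ k, rfl⟩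

theorem isRoot_of_torsion (h2 : w 2 < 1) (hB : w B ≤ 1) (hx : w x ≤ 1)
    (hM : max 1 (w A) ≤ w (x ^ 2 - A)) (hT : (A, B) ∈ TW x) : x ^ 3 + A * x + B = 0 := by
  obtain ⟨-, y, h, hfin⟩ := hT
  have heq := curve_nonsingular_eq h
  rw [← heq]
  by_contra hne
  obtain ⟨x', y', h', hadd, hx'⟩ := exists_double h (by rintro rfl; simp at hne)
  refine not_isOfFinAddOrder_of_max_lt w h2 hB (Point.some x' y' h')
    (max_lt_valuation_of_double w h2 hB hx hM heq hx') ?_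
  have hfin2 : IsOfFinAddOrder (2 • Point.some x y h) := hfin.nsmul
  rwa [two_nsmul, hadd] at hfin2

/-- Of two integral torsion `x`-coordinates with distinct reductions, at least one belongs to a
point of order two. -/
theorem isRoot_or_isRoot (h2 : w 2 < 1) (hB : w B ≤ 1) {a b : ℂ} (ha : w a ≤ 1) (hb : w b ≤ 1)
    (hab : w (a - b) = 1) (hTa : (A, B) ∈ TW a) (hTb : (A, B) ∈ TW b) :
    a ^ 3 + A * a + B = 0 ∨ b ^ 3 + A * b + B = 0 := by
  by_contra! hne
  have ha' := lt_of_not_ge fun hM => hne.1 (isRoot_of_torsion w h2 hB ha hM hTa)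
  have hb' := lt_of_not_ge fun hM => hne.2 (isRoot_of_torsion w h2 hB hb hM hTb)
  -- If `w A > 1`, then `A` dominates `a ^ 2` and `w (a ^ 2 - A)` attains the maximum.
  have hA : w A ≤ 1 := by
    by_contra! hA
    rw [max_eq_right hA.le, Valuation.map_sub_eq_of_lt_right] at ha'
    · exact ha'.false
    · rw [map_pow]
      exact (pow_le_one₀ zero_le ha).trans_lt hA
  rw [max_eq_left hA] at ha' hb'
  -- Modulo 2, `(a - b) ^ 2` is `a ^ 2 - b ^ 2`, and both squares reduce to `A`.
  have hlt : w ((a - b) ^ 2) < 1 := by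
    rw [show (a - b) ^ 2 = ((a ^ 2 - A) - (b ^ 2 - A)) - 2 * (b * (a - b)) by ring]
    refine w.map_sub_lt (w.map_sub_lt ha' hb') ?_
    rw [map_mul, map_mul, hab, mul_one]
    exact mul_lt_one_of_lt_of_le h2 hb
  simp [hab] at hlt

end Torsion

theorem eq_of_two_roots {A B a b : ℂ} (hab : a ≠ b) (ha : a ^ 3 + A * a + B = 0)
    (hb : b ^ 3 + A * b + B = 0) :
    (A, B) = (-(a ^ 2 + a * b + b ^ 2), a * b * (a + b)) := by
  have hA : A = -(a ^ 2 + a * b + b ^ 2) := by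
    refine mul_left_cancel₀ (sub_ne_zero.2 hab) ?_
    linear_combination ha - hb
  refine Prod.ext hA ?_
  subst hA
  linear_combination ha

theorem valuation_sub_eq_one_of_rho_ne (i : QBar →+* PadicAlgCl 2) {a b : QBar} (ha : a ∈ Z i)
    (hb : b ∈ Z i) (hab : rho i a ≠ rho i b) :
    (PadicAlgCl.valued 2).v (i (a - b)) = 1 := by
  have ha : i a ∈ IntQ2Bar := ha
  have hb : i b ∈ IntQ2Bar := hb
  have hu : IsLocalRing.residue IntQ2Bar (⟨i a, ha⟩ - ⟨i b, hb⟩) ≠ 0 := by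
    rw [map_sub, sub_ne_zero]
    simpa [rho, ha, hb] using hab
  have hu : IsUnit ((⟨i a, ha⟩ : IntQ2Bar) - ⟨i b, hb⟩) := by
    rwa [IsLocalRing.residue_ne_zero_iff_isUnit] at hu
  have := (Valuation.isEquiv_iff_val_eq_one.1
    (Valuation.isEquiv_valuation_valuationSubring (PadicAlgCl.valued 2).v)).2
      ((IntQ2Bar.valuation_eq_one_iff _).1 hu)
  simpa using this

/-- The valuation ring `Z` is dominated by a valuation ring of `ℂ`. -/
theorem exists_valuationSubring_complex (i : QBar →+* PadicAlgCl 2) :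
    ∃ V : ValuationSubring ℂ, V.valuation 2 < 1 ∧
      (∀ a ∈ Z i, V.valuation (a : ℂ) ≤ 1) ∧
      ∀ a ∈ Z i, ∀ b ∈ Z i, rho i a ≠ rho i b → V.valuation ((a : ℂ) - b) = 1 := by
  obtain ⟨V, hle, hlt⟩ := exists_valuationSubring_extending
    ((PadicAlgCl.valued 2).v.comap i) (algebraMap QBar ℂ)
  refine ⟨V, ?_, fun a ha => hle a ha, fun a ha b hb hab => ?_⟩
  · have h := PadicAlgCl.valuation_p 2
    have h2 := hlt 2 (by
      rw [Valuation.comap_apply, map_ofNat]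
      rw [Nat.cast_ofNat] at h
      rw [h, Nat.cast_ofNat]
      exact NNReal.half_lt_self one_ne_zero)
    rwa [map_ofNat] at h2
  · have h1 := valuation_sub_eq_one_of_rho_ne i ha hb hab
    refine le_antisymm (hle (a - b) h1.le) ?_
    -- The extension only transfers upper bounds; the lower bound comes from the inverse.
    have hinv := hle (a - b)⁻¹ (by
      rw [Valuation.comap_apply, map_inv₀, map_inv₀, h1, inv_one])
    rw [map_inv₀, map_inv₀] at hinv
    by_contra! hlt1
    have h0 : a - b ≠ 0 := by
      intro h
      simp [h] at h1
    have hpos : 0 < V.valuation (algebraMap QBar ℂ (a - b)) := by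
      simpa [Valuation.pos_iff, sub_eq_zero] using h0
    exact (one_lt_inv₀ hpos).2 hlt1 |>.not_ge hinv

end WeierstrassTorsion

theorem corollaryC
    (i : WeierstrassTorsion.QBar →+* PadicAlgCl 2)
    (α β γ : WeierstrassTorsion.QBar)
    (hα : α ∈ WeierstrassTorsion.Z i)
    (hβ : β ∈ WeierstrassTorsion.Z i)
    (hγ : γ ∈ WeierstrassTorsion.Z i)
    (hαβ : WeierstrassTorsion.rho i α ≠ WeierstrassTorsion.rho i β)
    (hαγ : WeierstrassTorsion.rho i α ≠ WeierstrassTorsion.rho i γ)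
    (hβγ : WeierstrassTorsion.rho i β ≠ WeierstrassTorsion.rho i γ) :
    WeierstrassTorsion.TWset {(α : ℂ), (β : ℂ), (γ : ℂ)} ∩
        (Set.univ ×ˢ
          ((fun z : WeierstrassTorsion.QBar => (z : ℂ)) '' (WeierstrassTorsion.Z i : Set WeierstrassTorsion.QBar))) ⊆
      ({(-((α : ℂ) ^ 2 + α * β + (β : ℂ) ^ 2), (α : ℂ) * β * (α + β)),
        (-((α : ℂ) ^ 2 + α * γ + (γ : ℂ) ^ 2), (α : ℂ) * γ * (α + γ)),
        (-((β : ℂ) ^ 2 + β * γ + (γ : ℂ) ^ 2), (β : ℂ) * γ * (β + γ))} : Set (ℂ × ℂ)) := by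
  obtain ⟨V, h2, hle, hsub⟩ := WeierstrassTorsion.exists_valuationSubring_complex i
  rintro ⟨A, B⟩ ⟨hT, -, ⟨B', hB', hBB'⟩⟩
  obtain rfl : (B' : ℂ) = B := hBB'
  simp only [WeierstrassTorsion.TWset, Set.mem_insert_iff, Set.mem_singleton_iff,
    Set.iInter_iInter_eq_or_left, Set.iInter_iInter_eq_left, Set.mem_inter_iff] at hT
  obtain ⟨hTα, hTβ, hTγ⟩ := hT
  have hne : ∀ {a b : WeierstrassTorsion.QBar},
      WeierstrassTorsion.rho i a ≠ WeierstrassTorsion.rho i b → (a : ℂ) ≠ b :=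
    fun h hab => h (congrArg _ (Subtype.ext hab))
  have hB := hle B' hB'
  have hor := fun {a b : WeierstrassTorsion.QBar} (ha : a ∈ WeierstrassTorsion.Z i)
      (hb : b ∈ WeierstrassTorsion.Z i) h =>
    WeierstrassTorsion.isRoot_or_isRoot (A := A) V.valuation h2 hB (hle a ha) (hle b hb)
      (hsub a ha b hb h)
  simp only [Set.mem_insert_iff, Set.mem_singleton_iff]
  rcases hor hα hβ hαβ hTα hTβ with ha | hb
  · rcases hor hβ hγ hβγ hTβ hTγ with hb | hc
    · exact Or.inl (WeierstrassTorsion.eq_of_two_roots (hne hαβ) ha hb)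
    · exact Or.inr (Or.inl (WeierstrassTorsion.eq_of_two_roots (hne hαγ) ha hc))
  · rcases hor hα hγ hαγ hTα hTγ with ha | hc
    · exact Or.inl (WeierstrassTorsion.eq_of_two_roots (hne hαβ) ha hb)
    · exact Or.inr (Or.inr (WeierstrassTorsion.eq_of_two_roots (hne hβγ) hb hc))
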